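/- Let $p$ be a prime, let $s\ge 1$, $m,n\ge 2$ and $2\le d\le \min\{m,n\}$ be integers, and let $\mathbb{Z}_{p^s}$ be the ring of integers modulo $p^s$. The inner rank $\rho(A)$ of a nonzero matrix $A\in\mathbb{Z}_{p^s}^{m\times n}$ is the least positive integer $r$ such that $A=BC$ for some $B\in\mathbb{Z}_{p^s}^{m\times r}$ and $C\in\mathbb{Z}_{p^s}^{r\times n}$, and $\rho(0)=0$. Let $\Gamma_d(\mathbb{Z}_{p^s}^{m\times n})$ be the simple graph whose vertices are the $m\times n$ matrices over $\mathbb{Z}_{p^s}$, in which two distinct matrices $A,B$ are adjacent if and only if $\rho(A-B)<d$. Let $\chi$ and $\omega$ denote the chromatic number and the clique number. If $n\ge m$, then $$\chi\left(\Gamma_d(\mathbb{Z}_{p^s}^{m\times n})\right)=\omega\left(\Gamma_d(\mathbb{Z}_{p^s}^{m\times n})\right)=p^{sn(d-1)}.$$ -/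

import Mathlib

/-- The inner rank of an `m × n` matrix `A` over `R`: the least `r` such that `A = B * C` with
`B` of size `m × r` and `C` of size `r × n`. The value `r = 0` is attained exactly by `A = 0`. -/
noncomputable def innerRank {R : Type*} [CommRing R] {m n : ℕ}
    (A : Matrix (Fin m) (Fin n) R) : ℕ :=
  sInf {r : ℕ | ∃ (B : Matrix (Fin m) (Fin r) R) (C : Matrix (Fin r) (Fin n) R), A = B * C}

theorem innerRank_neg {R : Type*} [CommRing R] {m n : ℕ} (A : Matrix (Fin m) (Fin n) R) :
    innerRank (-A) = innerRank A := by
  unfold innerRank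
  congr 1
  ext r
  constructor
  · rintro ⟨B, C, h⟩
    exact ⟨-B, C, by rw [Matrix.neg_mul, ← h, neg_neg]⟩
  · rintro ⟨B, C, h⟩
    exact ⟨-B, C, by rw [Matrix.neg_mul, ← h]⟩

/-- The generalized bilinear forms graph on the `m × n` matrices over `R`: two distinct matrices
are adjacent when their difference has inner rank less than `d`. -/
def bilinearFormsGraph (R : Type*) [CommRing R] (m n d : ℕ) :
    SimpleGraph (Matrix (Fin m) (Fin n) R) where
  Adj A B := A ≠ B ∧ innerRank (A - B) < d
  symm := ⟨fun A B h => ⟨h.1.symm, by rw [← neg_sub, innerRank_neg]; exact h.2⟩⟩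
  loopless := ⟨fun _ h => h.1 rfl⟩

/-! ### Counting p-torsion in finite abelian groups. -/

section Torsion

/-! The matrices supported on the first d - 1 rows form a clique of size p^(sn(d-1)). Since ω ≤ χ, a
colouring with that many colours finishes the proof. Colour a matrix by the Gabidulin syndromes, in
GF(p^n)^(d-1), of its s base-p digit matrices. If A ≠ B share a colour, let k be the first digit
where they differ: A - B = p^k D, and D mod p is a nonzero matrix with zero syndrome. If A - B had
inner rank below d, counting p-torsion (`finrank_span_rows_le_of_prime_pow_smul_eq_mul`) would give
D mod p rank at most d - 1, and `eq_zero_of_gabidulin_checks` would make it zero. -/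

theorem AddMonoidHom.card_ker_eq_index_range {G : Type*} [AddCommGroup G] [Finite G]
    (f : G →+ G) : Nat.card f.ker = f.range.index := by
  have h1 := AddSubgroup.card_mul_index f.ker
  have h2 := AddSubgroup.card_mul_index f.range
  rw [AddSubgroup.index_ker] at h1
  have h3 : 0 < Nat.card f.range := Nat.card_pos
  apply Nat.eq_of_mul_eq_mul_right h3
  rw [h1, ← h2, mul_comm]

theorem card_torsion_eq_index (A : Type*) [AddCommGroup A] [Finite A] (p : ℕ) :
    Nat.card {x : A // p • x = 0} = (nsmulAddMonoidHom (α := A) p).range.index := by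
  rw [← AddMonoidHom.card_ker_eq_index_range]
  exact Nat.card_congr (Equiv.subtypeEquivRight fun x => by simp [AddMonoidHom.mem_ker])

/-- For finite abelian groups, the `p`-torsion of a quotient is no larger than that of the
group itself. -/
theorem card_torsion_le_of_surjective {G H : Type*} [AddCommGroup G] [AddCommGroup H] [Finite G]
    [Finite H] (f : G →+ H) (hf : Function.Surjective f) (p : ℕ) :
    Nat.card {x : H // p • x = 0} ≤ Nat.card {x : G // p • x = 0} := by
  rw [card_torsion_eq_index H, card_torsion_eq_index G]
  have hmap : (nsmulAddMonoidHom (α := H) p).range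
      = (nsmulAddMonoidHom (α := G) p).range.map f := by
    ext y
    simp only [AddMonoidHom.mem_range, AddSubgroup.mem_map, nsmulAddMonoidHom_apply]
    constructor
    · rintro ⟨x, rfl⟩
      obtain ⟨g, rfl⟩ := hf x
      exact ⟨p • g, ⟨g, rfl⟩, map_nsmul f p g⟩
    · rintro ⟨_, ⟨g, rfl⟩, rfl⟩
      exact ⟨f g, (map_nsmul f p g).symm⟩
  -- The index of pH in H is that of pG + ker f in G, which divides the index of pG.
  rw [hmap, AddSubgroup.index_map, AddMonoidHom.range_eq_top.2 hf, AddSubgroup.index_top, mul_one]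
  exact Nat.le_of_dvd (Nat.pos_of_ne_zero AddSubgroup.index_ne_zero_of_finite)
    (AddSubgroup.index_dvd_of_le le_sup_left)

theorem card_torsion_pi_zmod_le {p N r : ℕ} (hp : 0 < p) [NeZero N] :
    Nat.card {v : Fin r → ZMod N // p • v = 0} ≤ p ^ r := by
  classical
  have e : {v : Fin r → ZMod N // p • v = 0} ≃ (Fin r → {a : ZMod N // p • a = 0}) :=
    (Equiv.subtypeEquivRight fun v => by simp [funext_iff]).trans
      (Equiv.subtypePiEquivPi (p := fun _ a => p • a = 0))
  rw [Nat.card_congr e, Nat.card_fun, Nat.card_eq_fintype_card, Nat.card_eq_fintype_card,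
    Fintype.card_fin, Fintype.card_subtype]
  exact Nat.pow_le_pow_left (IsAddCyclic.card_nsmul_eq_zero_le hp) r

end Torsion

/-! ### Linearized polynomials and Gabidulin codes. -/

section Moore

theorem FiniteField.sum_smul_pow_card_pow {F K ι : Type*} [Field F] [Fintype F] [Field K]
    [Algebra F K] [Fintype ι] (a : ι → F) (h : ι → K) (j : ℕ) :
    (∑ l, a l • h l) ^ Fintype.card F ^ j = ∑ l, a l • h l ^ Fintype.card F ^ j := by
  have hpow : ∀ x : K, (FiniteField.frobeniusAlgHom F K ^ j) x = x ^ Fintype.card F ^ j := by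
    intro x
    rw [AlgHom.coe_pow, FiniteField.coe_frobeniusAlgHom, pow_iterate]
  simp_rw [← hpow, map_sum, map_smul]

/-- A linearized polynomial of `q`-degree less than `r` that vanishes at `r` linearly independent
elements is zero. -/
theorem eq_zero_of_sum_mul_pow_card_pow_eq_zero {F K : Type*} [Field F] [Fintype F] [Field K]
    [Algebra F K] {r : ℕ} {h : Fin r → K} (hh : LinearIndependent F h) {c : Fin r → K}
    (hc : ∀ l, ∑ j, c j * h l ^ Fintype.card F ^ (j : ℕ) = 0) : c = 0 := by
  classical
  set q := Fintype.card F
  have hq : 1 < q := Fintype.one_lt_card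
  let P : Polynomial K := ∑ j : Fin r, Polynomial.monomial (q ^ (j : ℕ)) (c j)
  have hP : P = 0 := by
    -- All q^r combinations of the `h l` are roots, but the degree is at most q^(r-1).
    refine Polynomial.eq_zero_of_natDegree_lt_card_of_eval_eq_zero P
      (f := fun a : Fin r → F => ∑ l, a l • h l) ?_ ?_ ?_
    · exact linearIndependent_iff_injective_fintypeLinearCombination.1 hh
    · intro a
      simp only [P, Polynomial.eval_finsetSum, Polynomial.eval_monomial, q,
        FiniteField.sum_smul_pow_card_pow, Finset.mul_sum]
      rw [Finset.sum_comm]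
      refine Finset.sum_eq_zero fun l _ => ?_
      simp only [mul_smul_comm, ← Finset.smul_sum]
      rw [hc l, smul_zero]
    · rw [Fintype.card_fun, Fintype.card_fin]
      rcases Nat.eq_zero_or_pos r with rfl | hr
      · simp [P]
      · refine lt_of_le_of_lt (Polynomial.natDegree_sum_le_of_forall_le (n := q ^ (r - 1)) _ _ ?_)
          (Nat.pow_lt_pow_right hq (by omega))
        intro j _
        exact (Polynomial.natDegree_monomial_le _).trans
          (Nat.pow_le_pow_right hq.le (by omega))
  funext j
  have := congrArg (fun Q => Polynomial.coeff Q (q ^ (j : ℕ))) hP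
  simpa [P, Polynomial.finsetSum_coeff, Polynomial.coeff_monomial,
    (Nat.pow_right_injective hq).eq_iff, Fin.val_inj] using this

/-- A vector over an extension of a finite field that satisfies the first `t` Gabidulin parity
checks and whose entries span a space of dimension at most `t` is zero. -/
theorem eq_zero_of_gabidulin_checks {F K : Type*} [Field F] [Fintype F] [Field K]
    [Algebra F K] {m t : ℕ} {g : Fin m → K} (hg : LinearIndependent F g) {x : Fin m → K}
    (hx : ∀ j : Fin t, ∑ i, x i * g i ^ Fintype.card F ^ (j : ℕ) = 0)
    (hrank : Module.finrank F (Submodule.span F (Set.range x)) ≤ t) : x = 0 := by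
  classical
  set W := Submodule.span F (Set.range x)
  have : FiniteDimensional F W := FiniteDimensional.span_of_finite F (Set.finite_range x)
  set r := Module.finrank F W
  let y := Module.finBasis F W
  have hxW : ∀ i, x i ∈ W := fun i => Submodule.subset_span ⟨i, rfl⟩
  let b : Fin m → Fin r → F := fun i => y.repr ⟨x i, hxW i⟩
  have hxb : ∀ i, x i = ∑ l, b i l • (y l : K) := by
    intro i
    have := congrArg W.subtype (y.sum_repr ⟨x i, hxW i⟩)
    rw [map_sum] at this
    exact this.symm
  let h : Fin r → K := fun l => ∑ i, b i l • g i
  have hh : LinearIndependent F h := by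
    rw [Fintype.linearIndependent_iff]
    intro c hc
    have h0 : ∀ i, ∑ l, c l * b i l = 0 := by
      refine Fintype.linearIndependent_iff.1 hg _ ?_
      rw [← hc]
      simp only [h, Finset.smul_sum, Finset.sum_smul, smul_smul]
      exact Finset.sum_comm
    -- The functional with values `c` on the basis `y` kills every `x i`, hence all of `W`.
    let φ : W →ₗ[F] F := y.constr F c
    have hφ : ∀ w : W, φ w = 0 := by
      have hall : ∀ w (hw : w ∈ W), φ ⟨w, hw⟩ = 0 := by
        intro w hw
        induction hw using Submodule.span_induction with
        | mem w hw =>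
          obtain ⟨i, rfl⟩ := hw
          simp only [φ, Module.Basis.constr_apply_fintype, smul_eq_mul]
          rw [← h0 i]
          exact Finset.sum_congr rfl fun l _ => mul_comm _ _
        | zero => exact map_zero φ
        | add u v hu hv h1 h2 =>
          have := map_add φ ⟨u, hu⟩ ⟨v, hv⟩
          rw [h1, h2, add_zero] at this
          exact this
        | smul a u hu h1 =>
          have := map_smul φ a ⟨u, hu⟩
          rw [h1, smul_zero] at this
          exact this
      exact fun w => hall w w.2
    intro l
    have := hφ (y l)
    rwa [Module.Basis.constr_basis] at this
  -- In the basis `y`, the first r checks read `M` y = 0 for this Moore matrix; a left kernel vector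
  -- of it would be a forbidden linearized polynomial.
  let M : Matrix (Fin r) (Fin r) K := Matrix.of fun j l => h l ^ Fintype.card F ^ (j : ℕ)
  have hM : M.det ≠ 0 := by
    intro h0
    obtain ⟨v, hv, hv0⟩ := Matrix.exists_vecMul_eq_zero_iff.2 h0
    refine hv (eq_zero_of_sum_mul_pow_card_pow_eq_zero hh fun l => ?_)
    simpa [Matrix.vecMul, dotProduct, M] using congrFun hv0 l
  have hy : (fun l => (y l : K)) = 0 := by
    refine Matrix.eq_zero_of_mulVec_eq_zero hM (funext fun j => ?_)
    have h1 := hx ⟨j, j.2.trans_le hrank⟩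
    simp only [Matrix.mulVec, dotProduct, M, h, Matrix.of_apply,
      FiniteField.sum_smul_pow_card_pow, Pi.zero_apply]
    rw [← h1]
    simp only [hxb, Finset.sum_mul]
    rw [Finset.sum_comm]
    refine Finset.sum_congr rfl fun i _ => Finset.sum_congr rfl fun l _ => ?_
    rw [smul_mul_assoc, smul_mul_assoc, mul_comm]
  funext i
  rw [hxb i]
  exact Finset.sum_eq_zero fun l _ => by rw [show (y l : K) = 0 from congrFun hy l, smul_zero]

end Moore

/-! ### From factorizations modulo p^s to rank modulo p. -/

section RankBound

variable {p s : ℕ}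

theorem ZMod.prime_pow_pred_mul_eq_zero_iff (hp : p.Prime) (hs : s ≠ 0) (x : ZMod (p ^ s)) :
    (p : ZMod (p ^ s)) ^ (s - 1) * x = 0 ↔ ZMod.castHom (dvd_pow_self p hs) (ZMod p) x = 0 := by
  have : NeZero (p ^ s) := ⟨pow_ne_zero _ hp.ne_zero⟩
  obtain ⟨v, rfl⟩ := ZMod.natCast_zmod_surjective x
  rw [map_natCast, ZMod.natCast_eq_zero_iff, ← Nat.cast_pow, ← Nat.cast_mul,
    ZMod.natCast_eq_zero_iff]
  obtain ⟨t, rfl⟩ := Nat.exists_eq_succ_of_ne_zero hs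
  rw [Nat.succ_eq_add_one, Nat.add_sub_cancel, pow_succ]
  exact Nat.mul_dvd_mul_iff_left (pow_pos hp.pos t)

theorem ZMod.prime_pow_pred_mul_inj (hp : p.Prime) (hs : s ≠ 0) (x y : ZMod (p ^ s)) :
    (p : ZMod (p ^ s)) ^ (s - 1) * x = (p : ZMod (p ^ s)) ^ (s - 1) * y ↔
      ZMod.castHom (dvd_pow_self p hs) (ZMod p) x = ZMod.castHom (dvd_pow_self p hs) (ZMod p) y := by
  rw [← sub_eq_zero, ← mul_sub, ZMod.prime_pow_pred_mul_eq_zero_iff hp hs, map_sub, sub_eq_zero]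

/-- If `p ^ k • A` factors through `r` over `ZMod (p ^ s)` with `k < s`, then the reduction of `A`
modulo `p` has row rank at most `r`. -/
theorem finrank_span_rows_le_of_prime_pow_smul_eq_mul [Fact p.Prime] (hs : s ≠ 0) {k m n r : ℕ}
    (hk : k < s) (A : Matrix (Fin m) (Fin n) (ZMod (p ^ s)))
    (B : Matrix (Fin m) (Fin r) (ZMod (p ^ s))) (C : Matrix (Fin r) (Fin n) (ZMod (p ^ s)))
    (h : (p : ZMod (p ^ s)) ^ k • A = B * C) :
    Module.finrank (ZMod p) (Submodule.span (ZMod p) (Set.range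
      (A.map (ZMod.castHom (dvd_pow_self p hs) (ZMod p))))) ≤ r := by
  have hp : p.Prime := Fact.out
  have : NeZero (p ^ s) := ⟨pow_ne_zero _ hp.ne_zero⟩
  set π := ZMod.castHom (dvd_pow_self p hs) (ZMod p) with hπ
  have hlift : ∀ a : ZMod p, π ((a.val : ℕ) : ZMod (p ^ s)) = a := fun a => by
    rw [map_natCast, ZMod.natCast_zmod_val]
  set W := Submodule.span (ZMod p) (Set.range (A.map π))
  let f : (Fin r → ZMod (p ^ s)) →+ (Fin n → ZMod (p ^ s)) := C.vecMulLinear.toAddMonoidHom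
  -- Embeds `W` into the p-torsion of the row space of `C`, a quotient of (Z/p^s)^r, whose p-torsion
  -- has at most p^r elements.
  let ι : (Fin n → ZMod p) → (Fin n → ZMod (p ^ s)) :=
    fun w j => (p : ZMod (p ^ s)) ^ (s - 1) * ((w j).val : ℕ)
  have hι : Function.Injective ι := fun w w' hw => funext fun j => by
    have := (ZMod.prime_pow_pred_mul_inj hp hs _ _).1 (congrFun hw j)
    rwa [← hπ, hlift, hlift] at this
  have hrange : ∀ w ∈ W, ι w ∈ f.range := by
    intro w hw
    obtain ⟨c, rfl⟩ := (Submodule.mem_span_range_iff_exists_fun _).1 hw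
    let v : Fin m → ZMod (p ^ s) := fun i => ((c i).val : ℕ)
    refine ⟨(p : ZMod (p ^ s)) ^ (s - 1 - k) • Matrix.vecMul v B, ?_⟩
    have h1 : f ((p : ZMod (p ^ s)) ^ (s - 1 - k) • Matrix.vecMul v B)
        = (p : ZMod (p ^ s)) ^ (s - 1) • Matrix.vecMul v A := by
      change Matrix.vecMul ((p : ZMod (p ^ s)) ^ (s - 1 - k) • Matrix.vecMul v B) C = _
      rw [Matrix.smul_vecMul, Matrix.vecMul_vecMul, ← h, Matrix.vecMul_smul, smul_smul, ← pow_add]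
      congr 2
      omega
    rw [h1]
    funext j
    refine (ZMod.prime_pow_pred_mul_inj hp hs _ _).2 ?_
    rw [← hπ, hlift, Matrix.vecMul, dotProduct, map_sum, Finset.sum_apply]
    refine Finset.sum_congr rfl fun i _ => ?_
    rw [map_mul, hlift]
    rfl
  have htors : ∀ w, p • ι w = 0 := by
    intro w
    funext j
    have h0 : ((p ^ s : ℕ) : ZMod (p ^ s)) = 0 := ZMod.natCast_self _
    rw [Pi.smul_apply, nsmul_eq_mul, ← mul_assoc, ← pow_succ', Nat.sub_add_cancel (by omega),
      ← Nat.cast_pow, h0, zero_mul, Pi.zero_apply]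
  have hcard : Nat.card W ≤ Nat.card {x : f.range // p • x = 0} := by
    refine Nat.card_le_card_of_injective
      (fun w => ⟨⟨ι w, hrange w w.2⟩, Subtype.ext (htors w)⟩) fun w w' hw => ?_
    exact Subtype.ext (hι (congrArg (fun x => (x.1 : Fin n → ZMod (p ^ s))) hw))
  have h2 := (hcard.trans (card_torsion_le_of_surjective f.rangeRestrict
    f.rangeRestrict_surjective p)).trans (card_torsion_pi_zmod_le hp.pos)
  rw [Module.natCard_eq_pow_finrank (K := ZMod p), Nat.card_zmod] at h2
  exact (Nat.pow_le_pow_iff_right hp.one_lt).1 h2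

end RankBound

/-! ### The colouring by digit syndromes. -/

section Coloring

/-- A Gabidulin syndrome map: its kernel contains no nonzero matrix of row rank at most `t`. -/
theorem exists_gabidulin_syndrome (p : ℕ) [Fact p.Prime] {m n : ℕ} (hn : n ≠ 0) (hmn : m ≤ n)
    (t : ℕ) : ∃ φ : Matrix (Fin m) (Fin n) (ZMod p) →+ (Fin t → GaloisField p n),
      ∀ X, φ X = 0 → Module.finrank (ZMod p) (Submodule.span (ZMod p) (Set.range X)) ≤ t →
        X = 0 := by
  let b : Module.Basis (Fin n) (ZMod p) (GaloisField p n) :=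
    Module.finBasisOfFinrankEq _ _ (GaloisField.finrank p hn)
  let e : (Fin n → ZMod p) ≃ₗ[ZMod p] GaloisField p n := b.equivFun.symm
  let g : Fin m → GaloisField p n := fun i => b (Fin.castLE hmn i)
  have hg : LinearIndependent (ZMod p) g :=
    b.linearIndependent.comp _ (Fin.castLE_injective hmn)
  refine ⟨AddMonoidHom.mk' (fun X j => ∑ i, e (X i) * g i ^ p ^ (j : ℕ)) ?_, ?_⟩
  · intro X Y
    funext j
    simp only [Pi.add_apply, ← Finset.sum_add_distrib, ← add_mul, ← map_add]
    rfl
  · intro X hX hr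
    have hx : (fun i => e (X i)) = 0 := by
      refine eq_zero_of_gabidulin_checks (t := t) hg (fun j => ?_) ?_
      · rw [ZMod.card]
        exact congrFun hX j
      · have : Set.range (fun i => e (X i)) = e '' Set.range X := (Set.range_comp e X)
        rw [this, ← LinearEquiv.coe_coe, Submodule.span_image, LinearEquiv.finrank_map_eq]
        exact hr
    funext i
    exact e.map_eq_zero_iff.1 (congrFun hx i)

theorem exists_mul_eq_of_innerRank_lt {R : Type*} [CommRing R] {m n d : ℕ}
    {A : Matrix (Fin m) (Fin n) R} (h : innerRank A < d) :
    ∃ r < d, ∃ (B : Matrix (Fin m) (Fin r) R) (C : Matrix (Fin r) (Fin n) R), A = B * C :=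
  ⟨innerRank A, h, Nat.sInf_mem (s := {r : ℕ | ∃ (B : Matrix (Fin m) (Fin r) R)
    (C : Matrix (Fin r) (Fin n) R), A = B * C}) ⟨m, 1, A, (Matrix.one_mul A).symm⟩⟩

theorem Nat.mod_pow_eq_of_digits_eq {p a b k : ℕ}
    (h : ∀ i < k, a / p ^ i % p = b / p ^ i % p) : a % p ^ k = b % p ^ k := by
  induction k with
  | zero => simp [Nat.mod_one]
  | succ k ih =>
    rw [Nat.mod_pow_succ, Nat.mod_pow_succ, ih fun i hi => h i (by omega), h k (by omega)]

/-- The matrix of `i`-th base-`p` digits of a matrix over `ZMod (p ^ s)`. -/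
def digitMatrix (p s : ℕ) {m n : ℕ} (i : ℕ) (A : Matrix (Fin m) (Fin n) (ZMod (p ^ s))) :
    Matrix (Fin m) (Fin n) (ZMod p) :=
  A.map fun a => ((a.val / p ^ i : ℕ) : ZMod p)

/-- Distinct matrices over `ZMod (p ^ s)` differ by `p ^ k` times a matrix whose reduction modulo
`p` is the difference of their `k`-th digit matrices, at the first place where these differ. -/
theorem exists_sub_eq_prime_pow_smul {p s m n : ℕ} [Fact p.Prime] (hs : s ≠ 0)
    {A B : Matrix (Fin m) (Fin n) (ZMod (p ^ s))} (hAB : A ≠ B) :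
    ∃ k < s, ∃ D : Matrix (Fin m) (Fin n) (ZMod (p ^ s)), A - B = (p : ZMod (p ^ s)) ^ k • D ∧
      D.map (ZMod.castHom (dvd_pow_self p hs) (ZMod p)) = digitMatrix p s k A - digitMatrix p s k B
      ∧ digitMatrix p s k A ≠ digitMatrix p s k B := by
  classical
  have hp : p.Prime := Fact.out
  have : NeZero (p ^ s) := ⟨pow_ne_zero _ hp.ne_zero⟩
  have hmod : ∀ k, (∀ i < k, digitMatrix p s i A = digitMatrix p s i B) →
      ∀ x y, (A x y).val % p ^ k = (B x y).val % p ^ k := by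
    intro k hk x y
    refine Nat.mod_pow_eq_of_digits_eq fun i hi => ?_
    exact (ZMod.natCast_eq_natCast_iff' _ _ p).1 (congrFun (congrFun (hk i hi) x) y)
  have hex : ∃ k, k < s ∧ digitMatrix p s k A ≠ digitMatrix p s k B := by
    by_contra! hcon
    refine hAB (Matrix.ext fun x y => ZMod.val_injective _ ?_)
    have := hmod s hcon x y
    rwa [Nat.mod_eq_of_lt (ZMod.val_lt _), Nat.mod_eq_of_lt (ZMod.val_lt _)] at this
  obtain ⟨hks, hne⟩ := Nat.find_spec hex
  set k := Nat.find hex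
  have hlt : ∀ i < k, digitMatrix p s i A = digitMatrix p s i B := fun i hi => by
    by_contra hi'
    exact Nat.find_min hex hi ⟨hi.trans hks, hi'⟩
  refine ⟨k, hks, Matrix.of fun x y => (((A x y).val / p ^ k : ℕ) : ZMod (p ^ s))
    - (((B x y).val / p ^ k : ℕ) : ZMod (p ^ s)), ?_, ?_, hne⟩
  · ext x y
    have hdiv : ∀ a : ZMod (p ^ s), a = (p : ZMod (p ^ s)) ^ k * ((a.val / p ^ k : ℕ) : ZMod (p ^ s))
        + ((a.val % p ^ k : ℕ) : ZMod (p ^ s)) := fun a => by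
      rw [← Nat.cast_pow, ← Nat.cast_mul, ← Nat.cast_add, Nat.div_add_mod, ZMod.natCast_zmod_val]
    rw [Matrix.sub_apply, Matrix.smul_apply, Matrix.of_apply, smul_eq_mul, mul_sub]
    nth_rewrite 1 [hdiv (A x y), hdiv (B x y)]
    rw [hmod k hlt x y]
    ring
  · ext x y
    rw [Matrix.map_apply, Matrix.of_apply, map_sub, map_natCast, map_natCast]
    rfl

theorem bilinearFormsGraph_colorable {p s m n d : ℕ} (hp : p.Prime) (hs : s ≠ 0) (hn : n ≠ 0)
    (hmn : m ≤ n) (hd : 1 ≤ d) :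
    (bilinearFormsGraph (ZMod (p ^ s)) m n d).Colorable (p ^ (s * n * (d - 1))) := by
  classical
  have : Fact p.Prime := ⟨hp⟩
  obtain ⟨φ, hφ⟩ := exists_gabidulin_syndrome p hn hmn (d - 1)
  have : Fintype (GaloisField p n) := Fintype.ofFinite _
  have hcard : Fintype.card (Fin s → Fin (d - 1) → GaloisField p n) = p ^ (s * n * (d - 1)) := by
    rw [Fintype.card_fun, Fintype.card_fun, ← Nat.card_eq_fintype_card, GaloisField.card p n hn,
      Fintype.card_fin, Fintype.card_fin, ← pow_mul, ← pow_mul]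
    congr 1
    ring
  rw [← hcard]
  refine (SimpleGraph.Coloring.mk (fun A (i : Fin s) => φ (digitMatrix p s i A)) ?_).colorable
  rintro A B ⟨hne, hrank⟩ hcol
  obtain ⟨k, hk, D, hD, hDmap, hdig⟩ := exists_sub_eq_prime_pow_smul hs hne
  obtain ⟨r, hr, X, Y, hXY⟩ := exists_mul_eq_of_innerRank_lt hrank
  have h1 := finrank_span_rows_le_of_prime_pow_smul_eq_mul hs hk D X Y (hD.symm.trans hXY)
  refine hdig (sub_eq_zero.1 (hDmap ▸ hφ _ ?_ (h1.trans (by omega))))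
  rw [hDmap, map_sub, sub_eq_zero]
  exact congrFun hcol ⟨k, hk⟩

end Coloring

/-! ### The clique. -/

section Clique

theorem card_pow_le_cliqueNum_bilinearFormsGraph (R : Type*) [CommRing R] [Fintype R]
    {m n d : ℕ} (hd : 1 ≤ d) (hdm : d ≤ m) :
    Fintype.card R ^ (n * (d - 1)) ≤ (bilinearFormsGraph R m n d).cliqueNum := by
  classical
  let E : Matrix (Fin m) (Fin (d - 1)) R := Matrix.of fun i j => if (i : ℕ) = j then 1 else 0
  have hE : ∀ (C : Matrix (Fin (d - 1)) (Fin n) R) (j : Fin (d - 1)),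
      (E * C) ⟨j, by omega⟩ = C j := by
    intro C j
    funext y
    simp [E, Matrix.mul_apply, Fin.val_inj]
  have hinj : Function.Injective fun C : Matrix (Fin (d - 1)) (Fin n) R => E * C := by
    intro C C' h
    funext j
    rw [← hE C j, ← hE C' j]
    exact congrFun h _
  have hclique : (bilinearFormsGraph R m n d).IsClique
      ((Finset.univ.image fun C : Matrix (Fin (d - 1)) (Fin n) R => E * C : Finset _) :
        Set (Matrix (Fin m) (Fin n) R)) := by
    intro X hX Y hY hXY
    obtain ⟨C, -, rfl⟩ := Finset.mem_image.1 (Finset.mem_coe.1 hX)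
    obtain ⟨C', -, rfl⟩ := Finset.mem_image.1 (Finset.mem_coe.1 hY)
    refine ⟨hXY, lt_of_le_of_lt (Nat.sInf_le ⟨E, C - C', (Matrix.mul_sub E C C').symm⟩) ?_⟩
    omega
  have h1 := SimpleGraph.IsClique.card_le_cliqueNum (tc := hclique)
  rw [Finset.card_image_of_injective _ hinj, Finset.card_univ] at h1
  refine le_trans (le_of_eq ?_) h1
  rw [show Fintype.card (Matrix (Fin (d - 1)) (Fin n) R)
    = Fintype.card (Fin (d - 1) → Fin n → R) from rfl, Fintype.card_fun, Fintype.card_fun,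
    Fintype.card_fin, Fintype.card_fin, pow_mul]

end Clique

theorem mainTheorem4 (p s m n d : ℕ) (hp : p.Prime) (hs : 1 ≤ s) (hm : 2 ≤ m) (hn : 2 ≤ n)
    (hmn : m ≤ n) (hd : 2 ≤ d) (hd' : d ≤ min m n) :
    (bilinearFormsGraph (ZMod (p ^ s)) m n d).chromaticNumber =
        ((bilinearFormsGraph (ZMod (p ^ s)) m n d).cliqueNum : ℕ∞) ∧
      (bilinearFormsGraph (ZMod (p ^ s)) m n d).cliqueNum = p ^ (s * n * (d - 1)) := by
  have : NeZero (p ^ s) := ⟨pow_ne_zero _ hp.ne_zero⟩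
  have hupper := (bilinearFormsGraph_colorable (m := m) (n := n) (d := d) hp
    (by omega : s ≠ 0) (by omega) hmn (by omega)).chromaticNumber_le
  have hlower := card_pow_le_cliqueNum_bilinearFormsGraph (ZMod (p ^ s)) (n := n)
    (by omega : 1 ≤ d) (hd'.trans (min_le_left m n))
  rw [ZMod.card, ← pow_mul, ← mul_assoc] at hlower
  have hmid := SimpleGraph.cliqueNum_le_chromaticNumber
    (G := bilinearFormsGraph (ZMod (p ^ s)) m n d)
  have hω : (bilinearFormsGraph (ZMod (p ^ s)) m n d).cliqueNum = p ^ (s * n * (d - 1)) :=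
    le_antisymm (by exact_mod_cast hmid.trans hupper) hlower
  exact ⟨le_antisymm (hω ▸ hupper) hmid, hω⟩
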